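/- Let $n\ge 0$, let $(E,\sigma_E)$ be a complex symplectic vector space of dimension $2n$ and let $\{\epsilon_\alpha\}_{\alpha=\pm1,\dots,\pm n}$ be a basis of $E$ with $\sigma_E(\epsilon_\alpha,\epsilon_\beta)=\mathrm{sign}(\alpha)\,\delta_{\alpha,-\beta}$. For $u,v\in E$ let $u\odot v\in\mathfrak{sp}(n,\mathbb C)=\mathfrak{sp}(E,\sigma_E)$ be the endomorphism $w\mapsto \sigma_E(u,w)v+\sigma_E(v,w)u$, and put $x_{\alpha\beta}=-\mathrm{sign}(\beta)\,\epsilon_\alpha\odot\epsilon_{-\beta}$. In the universal enveloping algebra $U(\mathfrak{sp}(n,\mathbb C))$ let $x^q_{\alpha\beta}=\sum_{\alpha_1,\dots,\alpha_{q-1}}x_{\alpha\alpha_1}x_{\alpha_1\alpha_2}\cdots x_{\alpha_{q-1}\beta}$ for $q\ge1$, $x^0_{\alpha\beta}=\delta_{\alpha\beta}$, and $c_q=\sum_\alpha x^q_{\alpha\alpha}$. Let $\mathfrak R:E\times E\to\mathfrak{sp}(n,\mathbb C)$ be a bilinear map such that $\sigma_E(\mathfrak R(u_1,u_2)u_3,u_4)$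 is symmetric in $u_1,u_2,u_3,u_4$ (for instance, the $S^4(\mathbf E)$-part of the curvature tensor at a point of a quaternionic Kähler manifold of real dimension $4n$, with $E$ the fibre of $\mathbf E$ at that point). For a representation $\pi$ of $\mathfrak{sp}(n,\mathbb C)$ define the curvature endomorphisms $$\mathfrak R^q_\pi=\sum_{\alpha,\beta}\mathrm{sign}(\alpha)\,\pi\bigl(x^q_{\alpha\beta}\,\mathfrak R(\epsilon_{-\alpha},\epsilon_\beta)\bigr),\qquad q\ge 0 .$$ For $0\le b\le a\le n$ let $\Lambda^{a,b}_0(E)$, with representation $\pi_{(2_b,1_{a-b})}$, be the top irreducible summand of $\Lambda^a_0(E)\otimes\Lambda^b_0(E)$, that is, the irreducible $\mathfrak{sp}(n,\mathbb C)$-submodule with highest weight $(2_b,1_{a-b})=(2,\dots,2,1,\dots,1,0,\dots,0)$ ($b$ twos and $a-b$ ones) generated by $(\epsilon_1\wedge\dots\wedge\epsilon_a)\otimes(\epsilon_1\wedge\dots\wedge\epsilon_b)$. Here $\Lambda^a_0(E)\subset\Lambda^a(E)$ is the primitive space, the kernel of $\sum_\alpha \mathrm{sign}(\alpha)\,i(\epsilon_\alpha)i(\epsilon_{-\alpha})$,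 where $i(\epsilon_\alpha)$ denotes the contraction with the element of the dual basis that corresponds to $\epsilon_\alpha$. Then, for all $0\le b\le a\le n$, on $\Lambda^{a,b}_0(E)$ $$\mathfrak R^3_{(2_b,1_{a-b})}=\Bigl(2n^2+7n+7-\tfrac14\,\pi_{(2_b,1_{a-b})}(c_2)\Bigr)\,\mathfrak R^1_{(2_b,1_{a-b})}.$$ Moreover, for all $0\le a\le n$, $\mathfrak R^1_{(1_a)}=0$ on $\Lambda^a_0(E)\cong\Lambda^{a,0}_0(E)$. -/

import Mathlib

open scoped TensorProduct

attribute [local instance 100] LieRing.ofAssociativeRing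

noncomputable section

namespace QuaternionKahler

/-! ### The action of `End(E)` on exterior powers by derivations -/

section Derivation

variable {E : Type*} [AddCommGroup E] [Module ℂ E]

/-- The algebra homomorphism `ω ↦ ω + t D_A(ω)` (with `t ^ 2 = 0`) from the exterior algebra to
its dual numbers, where `D_A` is the derivation extending the endomorphism `A` of `E`. -/
def extDerAux (A : Module.End ℂ E) :
    ExteriorAlgebra ℂ E →ₐ[ℂ] TrivSqZeroExt (ExteriorAlgebra ℂ E) (ExteriorAlgebra ℂ E) :=
  ExteriorAlgebra.lift ℂ
    ⟨(TrivSqZeroExt.inlAlgHom ℂ (ExteriorAlgebra ℂ E) (ExteriorAlgebra ℂ E)).toLinearMap ∘ₗ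
        ExteriorAlgebra.ι ℂ +
      (TrivSqZeroExt.inrHom (ExteriorAlgebra ℂ E) (ExteriorAlgebra ℂ E)).restrictScalars ℂ ∘ₗ
        ExteriorAlgebra.ι ℂ ∘ₗ A, by
      intro m
      ext
      · simp
      · simp [ExteriorAlgebra.ι_add_mul_swap]⟩

/-- The derivation of the exterior algebra that extends an endomorphism `A` of `E`, that is,
`A (u₁ ∧ ⋯ ∧ uₐ) = ∑ᵢ u₁ ∧ ⋯ ∧ A uᵢ ∧ ⋯ ∧ uₐ`. -/
def extDer (A : Module.End ℂ E) : ExteriorAlgebra ℂ E →ₗ[ℂ] ExteriorAlgebra ℂ E :=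
  (TrivSqZeroExt.sndHom (ExteriorAlgebra ℂ E) (ExteriorAlgebra ℂ E)).restrictScalars ℂ ∘ₗ
    (extDerAux A).toLinearMap

theorem fst_extDerAux (A : Module.End ℂ E) (x : ExteriorAlgebra ℂ E) :
    (extDerAux A x).fst = x := by
  have h : (TrivSqZeroExt.fstHom ℂ (ExteriorAlgebra ℂ E) (ExteriorAlgebra ℂ E)).comp
      (extDerAux A) = AlgHom.id ℂ _ := by
    ext m
    simp [extDerAux]
  exact DFunLike.congr_fun h x

theorem extDer_ι (A : Module.End ℂ E) (u : E) :
    extDer A (ExteriorAlgebra.ι ℂ u) = ExteriorAlgebra.ι ℂ (A u) := by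
  simp [extDer, extDerAux]

theorem extDer_algebraMap (A : Module.End ℂ E) (r : ℂ) :
    extDer A (algebraMap ℂ _ r) = 0 := by
  simp [extDer, TrivSqZeroExt.algebraMap_eq_inl']

theorem extDer_mul (A : Module.End ℂ E) (x y : ExteriorAlgebra ℂ E) :
    extDer A (x * y) = extDer A x * y + x * extDer A y := by
  simp [extDer, fst_extDerAux, add_comm]

theorem extDer_add (A B : Module.End ℂ E) : extDer (A + B) = extDer A + extDer B := by
  refine LinearMap.ext fun x => ?_
  induction x using ExteriorAlgebra.induction with
  | algebraMap r => simp [extDer_algebraMap]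
  | ι u => simp [extDer_ι]
  | mul x y hx hy =>
    simp only [LinearMap.add_apply] at hx hy
    simp only [extDer_mul, LinearMap.add_apply, hx, hy, add_mul, mul_add]
    abel
  | add x y hx hy => simp only [map_add, hx, hy]

theorem extDer_smul (c : ℂ) (A : Module.End ℂ E) : extDer (c • A) = c • extDer A := by
  refine LinearMap.ext fun x => ?_
  induction x using ExteriorAlgebra.induction with
  | algebraMap r => simp [extDer_algebraMap]
  | ι u => simp [extDer_ι]
  | mul x y hx hy =>
    simp only [LinearMap.smul_apply] at hx hy
    simp [extDer_mul, hx, hy, smul_add]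
  | add x y hx hy => simp only [map_add, hx, hy]

theorem extDer_lie (A B : Module.End ℂ E) : extDer ⁅A, B⁆ =
    extDer A ∘ₗ extDer B - extDer B ∘ₗ extDer A := by
  refine LinearMap.ext fun x => ?_
  induction x using ExteriorAlgebra.induction with
  | algebraMap r => simp [extDer_algebraMap]
  | ι u => simp [extDer_ι, Ring.lie_def]
  | mul x y hx hy =>
    simp only [LinearMap.sub_apply, LinearMap.comp_apply] at hx hy
    simp only [extDer_mul, LinearMap.sub_apply, LinearMap.comp_apply, map_add, hx, hy]
    noncomm_ring
  | add x y hx hy => simp only [map_add, hx, hy]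

theorem extDer_mem (A : Module.End ℂ E) (a : ℕ) {x : ExteriorAlgebra ℂ E} (hx : x ∈ ⋀[ℂ]^a E) :
    extDer A x ∈ ⋀[ℂ]^a E := by
  refine Submodule.pow_induction_on_left' (M := LinearMap.range (ExteriorAlgebra.ι ℂ))
    (C := fun k y _ => extDer A y ∈ ⋀[ℂ]^k E) ?_ ?_ ?_ hx
  · intro r
    rw [extDer_algebraMap]
    exact zero_mem _
  · intro x y i _ _ h₁ h₂
    rw [map_add]
    exact add_mem h₁ h₂
  · rintro m ⟨u, rfl⟩ i x hx ih
    rw [extDer_mul, extDer_ι]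
    have e : ⋀[ℂ]^(i + 1) E = LinearMap.range (ExteriorAlgebra.ι ℂ (M := E)) * ⋀[ℂ]^i E :=
      pow_succ' _ _
    rw [Nat.succ_eq_add_one, e]
    exact add_mem (Submodule.mul_mem_mul ⟨_, rfl⟩ hx) (Submodule.mul_mem_mul ⟨_, rfl⟩ ih)

variable (E) in
/-- The exterior power `Λ^a(E)`, as a complex vector space. -/
def ExtPower (a : ℕ) : Type _ := ⋀[ℂ]^a E

instance (a : ℕ) : AddCommGroup (ExtPower E a) := inferInstanceAs (AddCommGroup (⋀[ℂ]^a E))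

instance (a : ℕ) : Module ℂ (ExtPower E a) := inferInstanceAs (Module ℂ (⋀[ℂ]^a E))

variable (E) in
/-- The inclusion of `Λ^a(E)` into the exterior algebra. -/
def ExtPower.incl (a : ℕ) : ExtPower E a →ₗ[ℂ] ExteriorAlgebra ℂ E := (⋀[ℂ]^a E).subtype

theorem ExtPower.incl_injective (a : ℕ) : Function.Injective (ExtPower.incl E a) :=
  Submodule.injective_subtype _

/-- The endomorphism of `Λ^a(E)` induced by the derivation that extends `A`. -/
def ExtPower.act (a : ℕ) (A : Module.End ℂ E) : Module.End ℂ (ExtPower E a) :=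
  (extDer A).restrict (p := ⋀[ℂ]^a E) (q := ⋀[ℂ]^a E) fun _ hx => extDer_mem A a hx

theorem ExtPower.incl_act (a : ℕ) (A : Module.End ℂ E) (ω : ExtPower E a) :
    ExtPower.incl E a (ExtPower.act a A ω) = extDer A (ExtPower.incl E a ω) := rfl

/-- `End(E)`, hence each of its Lie subalgebras, acts on `Λ^a(E)` by derivations. -/
instance (a : ℕ) : LieRingModule (Module.End ℂ E) (ExtPower E a) where
  bracket A ω := ExtPower.act a A ω
  add_lie A B ω := ExtPower.incl_injective a (by simp [ExtPower.incl_act, extDer_add])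
  lie_add A ω η := map_add _ ω η
  leibniz_lie A B ω := ExtPower.incl_injective a (by simp [ExtPower.incl_act, extDer_lie])

theorem ExtPower.lie_def (a : ℕ) (A : Module.End ℂ E) (ω : ExtPower E a) :
    ⁅A, ω⁆ = ExtPower.act a A ω := rfl

instance (a : ℕ) : LieModule ℂ (Module.End ℂ E) (ExtPower E a) where
  smul_lie c A ω := ExtPower.incl_injective a
    (by simp [ExtPower.lie_def, ExtPower.incl_act, extDer_smul])
  lie_smul c A ω := map_smul _ c ω

end Derivation

/-! ### Symplectic spaces, `sp(n, ℂ)` and its enveloping algebra -/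

/-- The index set `{±1, …, ±n}`: an absolute value (counted from `0`) and a sign. -/
abbrev SymIdx (n : ℕ) : Type := Fin n × ℤˣ

/-- The index `-α`. -/
def SymIdx.opp {n : ℕ} (α : SymIdx n) : SymIdx n := (α.1, -α.2)

/-- `sign(α) = ±1` as a complex number. -/
def SymIdx.sgn {n : ℕ} (α : SymIdx n) : ℂ := ((α.2 : ℤ) : ℂ)

/-- A symplectic form `σ` on a complex vector space `E`, together with a basis `ε_α`,
`α = ±1, …, ±n`, such that `σ(ε_α, ε_β) = sign(α) δ_{α,-β}`. -/
structure SymplecticFrame (n : ℕ) (E : Type*) [AddCommGroup E] [Module ℂ E] where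
  form : LinearMap.BilinForm ℂ E
  alt : form.IsAlt
  frame : Module.Basis (SymIdx n) ℂ E
  form_frame : ∀ α β, form (frame α) (frame β) = if α = β.opp then α.sgn else 0

namespace SymplecticFrame

variable {n : ℕ} {E : Type*} [AddCommGroup E] [Module ℂ E] (S : SymplecticFrame n E)

/-- The Lie algebra `sp(n, ℂ)` of endomorphisms `A` of `E` with `σ(A u, v) + σ(u, A v) = 0`. -/
abbrev sp : LieSubalgebra ℂ (Module.End ℂ E) := skewAdjointLieSubalgebra S.form

/-- The endomorphism `u ⊙ v : w ↦ σ(u, w) v + σ(v, w) u`, an element of `sp(n, ℂ)`. -/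
def odot (u v : E) : S.sp :=
  ⟨(S.form u).smulRight v + (S.form v).smulRight u, by
    change _ ∈ S.form.skewAdjointSubmodule
    rw [LinearMap.mem_skewAdjointSubmodule]
    intro x y
    have h₁ := S.alt.neg_eq v x
    have h₂ := S.alt.neg_eq u x
    simp only [LinearMap.add_apply, LinearMap.smulRight_apply, map_add, map_smul,
      LinearMap.smul_apply, smul_eq_mul, Pi.neg_apply, map_neg, ← h₁, ← h₂]
    ring⟩

/-- The elements `x_{αβ} = -sign(β) ε_α ⊙ ε_{-β}` of `sp(n, ℂ)`. -/
def x (α β : SymIdx n) : S.sp := (-β.sgn) • S.odot (S.frame α) (S.frame β.opp)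

/-- The universal enveloping algebra `U(sp(n, ℂ))`. -/
abbrev Env : Type _ := UniversalEnvelopingAlgebra ℂ S.sp

/-- The matrix `(x_{αβ})` with entries in `U(sp(n, ℂ))`. Its powers have the entries
`x^q_{αβ} = ∑ x_{αα₁} x_{α₁α₂} ⋯ x_{α_{q-1}β}` and `x^0_{αβ} = δ_{αβ}`. -/
def xMatrix : Matrix (SymIdx n) (SymIdx n) S.Env :=
  Matrix.of fun α β => UniversalEnvelopingAlgebra.ι ℂ (S.x α β)

/-- The Casimir element `c_q = ∑_α x^q_{αα}`. -/
def casimir (q : ℕ) : S.Env := ∑ α, (S.xMatrix ^ q) α α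

/-- The bilinear `sp(n, ℂ)`-valued map `R` belongs to `S⁴(E)`: the four-linear form
`σ(R(u₁, u₂) u₃, u₄)` is symmetric in all four arguments. -/
def IsHyperCurvature (R : E →ₗ[ℂ] E →ₗ[ℂ] S.sp) : Prop :=
  ∀ (u : Fin 4 → E) (p : Equiv.Perm (Fin 4)),
    S.form ((R (u (p 0)) (u (p 1)) : Module.End ℂ E) (u (p 2))) (u (p 3)) =
      S.form ((R (u 0) (u 1) : Module.End ℂ E) (u 2)) (u 3)

/-- The element `∑_{α,β} sign(α) x^q_{αβ} R(ε_{-α}, ε_β)` of `U(sp(n, ℂ))`. -/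
def curvElement (R : E →ₗ[ℂ] E →ₗ[ℂ] S.sp) (q : ℕ) : S.Env :=
  ∑ α, ∑ β, α.sgn • ((S.xMatrix ^ q) α β *
    UniversalEnvelopingAlgebra.ι ℂ (R (S.frame α.opp) (S.frame β)))

section Representation

variable (V : Type*) [AddCommGroup V] [Module ℂ V] [LieRingModule S.sp V] [LieModule ℂ S.sp V]

/-- The action `π` of the enveloping algebra on an `sp(n, ℂ)`-module `V`. -/
def rep : S.Env →ₐ[ℂ] Module.End ℂ V :=
  UniversalEnvelopingAlgebra.lift ℂ (LieModule.toEnd ℂ S.sp V)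

/-- The curvature endomorphism `∑_{α,β} sign(α) π(x^q_{αβ} R(ε_{-α}, ε_β))` of `V`. -/
def curvEnd (R : E →ₗ[ℂ] E →ₗ[ℂ] S.sp) (q : ℕ) : Module.End ℂ V :=
  S.rep V (S.curvElement R q)

end Representation

/-! ### The modules `Λ^a_0(E)` and `Λ^{a,b}_0(E)` -/

/-- The contraction `∑_α sign(α) i(ε_α) i(ε_{-α})` of exterior forms with the symplectic form,
where `i(ε_α)` is the interior product dual to `ε_α ∧`. -/
def contraction : ExteriorAlgebra ℂ E →ₗ[ℂ] ExteriorAlgebra ℂ E :=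
  ∑ α : SymIdx n, α.sgn •
    (CliffordAlgebra.contractLeft (Q := (0 : QuadraticForm ℂ E)) (S.frame.coord α) ∘ₗ
      CliffordAlgebra.contractLeft (Q := (0 : QuadraticForm ℂ E)) (S.frame.coord α.opp))

/-- The primitive space `Λ^a_0(E)`: the kernel in `Λ^a(E)` of the contraction with the symplectic
form. -/
def primitive (a : ℕ) : Submodule ℂ (ExtPower E a) :=
  LinearMap.ker (S.contraction ∘ₗ ExtPower.incl E a)

/-- The highest weight vector `ε_1 ∧ ⋯ ∧ ε_a` of `Λ^a_0(E)`, of weight `(1_a)`. -/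
def topVector {a : ℕ} (ha : a ≤ n) : ExtPower E a :=
  exteriorPower.ιMulti ℂ a (fun i => S.frame (Fin.castLE ha i, 1) : Fin a → E)

/-- `Λ^{a,b}_0(E)`, the top irreducible summand of `Λ^a_0(E) ⊗ Λ^b_0(E)`: the
`sp(n, ℂ)`-submodule generated by the vector `(ε_1 ∧ ⋯ ∧ ε_a) ⊗ (ε_1 ∧ ⋯ ∧ ε_b)` of highest weight
`(2_b, 1_{a-b})` (for `b ≤ a ≤ n`). -/
def topSummand {a b : ℕ} (ha : a ≤ n) (hb : b ≤ n) :
    LieSubmodule ℂ S.sp ((ExtPower E a) ⊗[ℂ] (ExtPower E b)) :=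
  LieSubmodule.lieSpan ℂ S.sp {S.topVector ha ⊗ₜ[ℂ] S.topVector hb}

end SymplecticFrame

end QuaternionKahler

end

/-!
The element `R` of `S⁴(E)` only sees the part of `X³(u₁, u₂) X(u₃, u₄)` that is symmetric in the
`uᵢ`, where `X(u, v) = π(u ⊙ v)`, so by polarization the arguments may be taken to be equal.
On `Λ(E) ⊗ Λ(E)` the creation and annihilation operators are fermions `Φ(f, u)` with `f` in a
symplectic space `(ℂ⁴, τ)`, the algebras `sp(E)` and `sp(2)` form a Howe dual pair, and up to a
multiple of `σ` the operator `X(u, v)` is the contraction of `Φ(·, u) Φ(·, v)` with `τ`. For fixed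
`w` the operators `Φ(·, w)` anticommute and span a space of dimension at most four, so
`q = X(w, w)` is quadratic in them and a degree four product is a multiple of `q²`:
`Φ(f, w) Φ(g, w) q = ¼ τ(f, g) q²`. This turns `X³(w, w) q` into the product of `q²` with a
quadratic expression in the generators of `sp(2)`, which is the Casimir element `c₂` up to
constants.
On a single `Λ(E)`, the endomorphism `w ⊙ w` acts by twice the product of the exterior and the
interior multiplication with `w`, the square of which is zero, so that `ℜ¹ = 0`.
-/

noncomputable section

namespace QuaternionKahler

set_option maxSynthPendingDepth 3

section Polarization

variable {ι I R E M A : Type*} [CommRing R] [AddCommGroup E] [Module R E]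

open Finset in
theorem sum_surjective_comp_eq_zero [Fintype ι] [DecidableEq ι] [AddCommGroup M] [Module R M]
    (F : MultilinearMap R (fun _ : ι => E) M) (hF : ∀ w, (F fun _ => w) = 0) (v : ι → E)
    [DecidablePred fun r : ι → ι => Function.Surjective r] :
    ∑ r : ι → ι with Function.Surjective r, F (v ∘ r) = 0 := by
  let avoid (i : ι) : Finset (ι → ι) := univ.filter (i ∉ Set.range ·)
  have hsurj : univ.filter (Function.Surjective (α := ι) (β := ι)) =
      univ.inf fun i => (avoid i)ᶜ := by
    ext r
    simp [mem_inf, avoid, Function.Surjective]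
  have hinf (t : Finset ι) : t.inf avoid = Fintype.piFinset fun _ => tᶜ := by
    ext r
    simp only [mem_inf, avoid, mem_filter_univ, Set.mem_range, not_exists, Fintype.mem_piFinset,
      mem_compl]
    exact ⟨fun h i hi => h _ hi i rfl, fun h i hi j hj => h j (hj ▸ hi)⟩
  rw [hsurj, inclusion_exclusion_sum_inf_compl]
  refine sum_eq_zero fun t _ => ?_
  have hzero : ∑ r ∈ Fintype.piFinset fun _ => tᶜ, F (v ∘ r) = 0 :=
    (F.map_sum_finset (fun _ j => v j) fun _ => tᶜ).symm.trans (hF _)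
  rw [hinf, hzero, smul_zero]

theorem sum_symm_smul_eq_zero [Fintype ι] [DecidableEq ι] [Fintype I]
    [AddCommGroup M] [Module R M] [IsAddTorsionFree M]
    (F : MultilinearMap R (fun _ : ι => E) M) (hF : ∀ w, (F fun _ => w) = 0)
    (ε : I → E) (T : (ι → I) → R) (hT : ∀ (i : ι → I) (p : Equiv.Perm ι), T (i ∘ p) = T i) :
    ∑ i, T i • F (ε ∘ i) = 0 := by
  have hperm (r : ι → ι) (hr : Function.Surjective r) :
      ∑ i, T i • F ((ε ∘ i) ∘ r) = ∑ i, T i • F (ε ∘ i) := by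
    let p : Equiv.Perm ι := Equiv.ofBijective r (Finite.surjective_iff_bijective.mp hr)
    exact Fintype.sum_equiv (p.symm.arrowCongr (Equiv.refl I)) _ _ fun i => by
      rw [← hT i p]; rfl
  have hcount : (Finset.univ.filter (Function.Surjective (α := ι) (β := ι))).card •
      ∑ i, T i • F (ε ∘ i) = 0 := by
    rw [← Finset.sum_const, ← Finset.sum_congr rfl fun r hr => hperm r (Finset.mem_filter.mp hr).2,
      Finset.sum_comm]
    refine Finset.sum_eq_zero fun i _ => ?_
    rw [← Finset.smul_sum, sum_surjective_comp_eq_zero F hF, smul_zero]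
  refine (nsmul_eq_zero_iff_right ?_).mp hcount
  exact Finset.card_ne_zero_of_mem (a := id) (by simp [Function.surjective_id])

theorem sum_symm_smul_mul_eq_zero [Fintype I] [Ring A] [Algebra R A] [IsAddTorsionFree A]
    (f g : E →ₗ[R] E →ₗ[R] A) (h : ∀ w, f w w * g w w = 0) (ε : I → E)
    (T : (Fin 4 → I) → R) (hT : ∀ (i : Fin 4 → I) (p : Equiv.Perm (Fin 4)), T (i ∘ p) = T i) :
    ∑ i, T i • (f (ε (i 0)) (ε (i 1)) * g (ε (i 2)) (ε (i 3))) = 0 :=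
  sum_symm_smul_eq_zero
    (MultilinearMap.mk' (fun w => f (w 0) (w 1) * g (w 2) (w 3))
      (fun m i x y => by fin_cases i <;> simp [add_mul, mul_add])
      (fun m i c x => by fin_cases i <;> simp)) h ε T hT

theorem sum_fin_four [Fintype I] [AddCommMonoid M] (g : I → I → I → I → M) :
    ∑ f : Fin 4 → I, g (f 0) (f 1) (f 2) (f 3) = ∑ i, ∑ j, ∑ k, ∑ l, g i j k l := by
  simp only [← (Fin.consEquiv fun _ => I).sum_comp, Fintype.sum_prod_type, Fintype.sum_unique]
  rfl

end Polarization

namespace SymIdx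

variable {n : ℕ}

@[simp] theorem opp_opp (α : SymIdx n) : α.opp.opp = α := by
  simp [SymIdx.opp]

@[simp] theorem sgn_opp (α : SymIdx n) : α.opp.sgn = -α.sgn := by
  simp [SymIdx.opp, SymIdx.sgn]

theorem sgn_mul_sgn (α : SymIdx n) : α.sgn * α.sgn = 1 := by
  rcases Int.units_eq_one_or α.2 with h | h <;> simp [SymIdx.sgn, h]

theorem sum_opp {M : Type*} [AddCommMonoid M] (f : SymIdx n → M) :
    ∑ α : SymIdx n, f α.opp = ∑ α : SymIdx n, f α :=
  Fintype.sum_equiv ⟨SymIdx.opp, SymIdx.opp, SymIdx.opp_opp, SymIdx.opp_opp⟩ _ _ fun _ => rfl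

end SymIdx

namespace SymplecticFrame

section Contraction

variable {n k : ℕ} {E F : Type*} [AddCommGroup E] [Module ℂ E] [AddCommGroup F] [Module ℂ F]
  (S : SymplecticFrame n E) (T : SymplecticFrame k F)
  {M N A : Type*} [AddCommGroup M] [Module ℂ M] [AddCommGroup N] [Module ℂ N]
  [Ring A] [Algebra ℂ A]

theorem form_frame_opp (μ : SymIdx n) : S.form (S.frame μ) (S.frame μ.opp) = μ.sgn := by
  simp [S.form_frame]

/-- The contraction `∑_μ sign(μ) B(ε_μ, ε_{-μ})` of a map of two arguments in `E` with the inverse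
of the symplectic form. Functions `B` that are not bilinear are admitted in order to save the
bundling of multilinear maps. -/
def contr (B : E → E → M) : M :=
  ∑ μ : SymIdx n, μ.sgn • B (S.frame μ) (S.frame μ.opp)

theorem contr_swap (B : E → E → M) : S.contr (fun a b => B b a) = -S.contr B := by
  rw [contr, contr, ← SymIdx.sum_opp, ← Finset.sum_neg_distrib]
  exact Finset.sum_congr rfl fun μ _ => by simp

theorem contr_add (B C : E → E → M) :
    S.contr (fun a b => B a b + C a b) = S.contr B + S.contr C := by
  simp only [contr, smul_add, Finset.sum_add_distrib]

theorem contr_neg (B : E → E → M) : S.contr (fun a b => -B a b) = -S.contr B := by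
  simp only [contr, smul_neg, Finset.sum_neg_distrib]

theorem contr_sub (B C : E → E → M) :
    S.contr (fun a b => B a b - C a b) = S.contr B - S.contr C := by
  simp only [contr, smul_sub, Finset.sum_sub_distrib]

theorem map_contr (f : M →ₗ[ℂ] N) (B : E → E → M) :
    f (S.contr B) = S.contr fun a b => f (B a b) := by
  simp only [contr, map_sum, map_smul]

theorem contr_smul (c : ℂ) (B : E → E → M) : S.contr (fun a b => c • B a b) = c • S.contr B :=
  (S.map_contr (c • LinearMap.id) B).symm

theorem mul_contr (x : A) (B : E → E → A) : x * S.contr B = S.contr fun a b => x * B a b :=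
  S.map_contr (LinearMap.mulLeft ℂ x) B

theorem contr_mul (x : A) (B : E → E → A) : S.contr B * x = S.contr fun a b => B a b * x :=
  S.map_contr (LinearMap.mulRight ℂ x) B

theorem contr_comm (B : E → E → F → F → M) :
    S.contr (fun a b => T.contr fun c d => B a b c d) =
      T.contr fun c d => S.contr fun a b => B a b c d := by
  simp only [contr, Finset.smul_sum]
  rw [Finset.sum_comm]
  simp only [smul_comm (SymIdx.sgn _) (SymIdx.sgn _)]

theorem contr_form_left (g : E →ₗ[ℂ] M) (v : E) :
    S.contr (fun a b => S.form a v • g b) = g v := by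
  have key : ∑ μ : SymIdx n, (μ.sgn • S.form (S.frame μ)).smulRight (S.frame μ.opp) =
      LinearMap.id := by
    refine S.frame.ext fun ν => ?_
    simp only [LinearMap.sum_apply, LinearMap.smulRight_apply, LinearMap.smul_apply, S.form_frame]
    rw [Finset.sum_eq_single ν.opp (by intro b _ hb; simp [hb]) (by simp)]
    simp [SymIdx.sgn_mul_sgn]
  have hv := congrArg g (LinearMap.congr_fun key v)
  simpa [contr, mul_smul] using hv

theorem contr_form_right (g : E →ₗ[ℂ] M) (v : E) :
    S.contr (fun a b => S.form b v • g a) = -g v := by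
  rw [S.contr_swap fun a b => S.form a v • g b, S.contr_form_left]

theorem contr_form_smul (x : M) : S.contr (fun a b => S.form a b • x) = (2 * n : ℂ) • x := by
  simp only [contr, form_frame_opp, smul_smul, SymIdx.sgn_mul_sgn, one_smul, Finset.sum_const,
    Finset.card_univ, Fintype.card_prod, Fintype.card_fin, Fintype.card_units_int,
    ← Nat.cast_smul_eq_nsmul ℂ, mul_comm n 2, Nat.cast_mul, Nat.cast_ofNat]

end Contraction

section Convolution

variable {n k : ℕ} {E F E₁ E₂ : Type*} [AddCommGroup E] [Module ℂ E] [AddCommGroup F] [Module ℂ F]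
  [AddCommGroup E₁] [Module ℂ E₁] [AddCommGroup E₂] [Module ℂ E₂]
  (S : SymplecticFrame n E) (T : SymplecticFrame k F) {A : Type*} [Ring A] [Algebra ℂ A]

/-- The composition `(f * g)(u, v) = ∑_μ sign(μ) f(u, ε_μ) g(ε_{-μ}, v)` of algebra-valued bilinear
maps, which are regarded as matrices by means of the symplectic form. -/
def conv : (E₁ →ₗ[ℂ] E →ₗ[ℂ] A) →ₗ[ℂ] (E →ₗ[ℂ] E₂ →ₗ[ℂ] A) →ₗ[ℂ] E₁ →ₗ[ℂ] E₂ →ₗ[ℂ] A :=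
  LinearMap.mk₂ ℂ
    (fun f g => S.contr fun a b => (LinearMap.mul ℂ A).compl₁₂ (f.flip a) (g b))
    (fun f f' g => by rw [← S.contr_add]; congr; ext; simp)
    (fun c f g => by rw [← S.contr_smul]; congr; ext; simp)
    (fun f g g' => by rw [← S.contr_add]; congr; ext; simp [mul_add])
    (fun c f g => by rw [← S.contr_smul]; congr; ext; simp)

theorem conv_apply (f : E₁ →ₗ[ℂ] E →ₗ[ℂ] A) (g : E →ₗ[ℂ] E₂ →ₗ[ℂ] A) (u : E₁) (v : E₂) :
    S.conv f g u v = S.contr fun a b => f u a * g b v :=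
  S.map_contr (LinearMap.applyₗ v ∘ₗ LinearMap.applyₗ u) _

theorem conv_assoc (f : E₁ →ₗ[ℂ] E →ₗ[ℂ] A) (g : E →ₗ[ℂ] F →ₗ[ℂ] A) (h : F →ₗ[ℂ] E₂ →ₗ[ℂ] A) :
    T.conv (S.conv f g) h = S.conv f (T.conv g h) := by
  ext u v
  simp only [conv_apply, contr_mul, mul_contr, mul_assoc]
  exact T.contr_comm S _

/-- The symplectic form with values in an algebra. -/
def formAlg (A : Type*) [Ring A] [Algebra ℂ A] : E →ₗ[ℂ] E →ₗ[ℂ] A :=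
  S.form.compr₂ (Algebra.linearMap ℂ A)

theorem formAlg_apply (u v : E) : S.formAlg A u v = S.form u v • 1 :=
  Algebra.algebraMap_eq_smul_one _

theorem formAlg_self (u : E) : S.formAlg A u u = 0 := by
  rw [formAlg_apply, S.alt u, zero_smul]

theorem contr_formAlg : S.contr (fun u v => S.formAlg A u v) = (2 * n : ℂ) • 1 := by
  simp only [formAlg_apply, contr_form_smul]

theorem form_swap (u v : E) : S.form u v = -S.form v u := (S.alt.neg_eq v u).symm

theorem formAlg_conv (g : E →ₗ[ℂ] E₂ →ₗ[ℂ] A) : S.conv (S.formAlg A) g = -g := by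
  ext u v
  simp only [conv_apply, formAlg_apply, S.form_swap u, neg_smul, neg_mul, smul_one_mul, contr_neg]
  exact congrArg Neg.neg (S.contr_form_left (g.flip v) u)

theorem conv_formAlg (f : E₁ →ₗ[ℂ] E →ₗ[ℂ] A) : S.conv f (S.formAlg A) = -f := by
  ext u v
  simp only [conv_apply, formAlg_apply, mul_smul_one]
  rw [S.contr_form_right, LinearMap.neg_apply, LinearMap.neg_apply]

/-- The powers of an algebra-valued bilinear map with respect to `conv`. By `formAlg_conv` and
`conv_formAlg`, the unit is `-σ`. -/
def convPow (X : E →ₗ[ℂ] E →ₗ[ℂ] A) : ℕ → (E →ₗ[ℂ] E →ₗ[ℂ] A)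
  | 0 => -S.formAlg A
  | q + 1 => S.conv (convPow X q) X

theorem convPow_one (X : E →ₗ[ℂ] E →ₗ[ℂ] A) : S.convPow X 1 = X := by
  rw [convPow, convPow, map_neg, LinearMap.neg_apply, formAlg_conv, neg_neg]

theorem convPow_two (X : E →ₗ[ℂ] E →ₗ[ℂ] A) : S.convPow X 2 = S.conv X X := by
  rw [convPow, convPow_one]

theorem convPow_three (X : E →ₗ[ℂ] E →ₗ[ℂ] A) :
    S.convPow X 3 = S.conv (S.conv X X) X := by
  rw [convPow, convPow_two]

theorem convPow_add_formAlg_two (Y : E →ₗ[ℂ] E →ₗ[ℂ] A) :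
    S.convPow (Y + (2 : ℂ) • S.formAlg A) 2 =
      S.conv Y Y - (4 : ℂ) • Y - (4 : ℂ) • S.formAlg A := by
  simp only [convPow_two, map_add, map_smul, LinearMap.add_apply, LinearMap.smul_apply,
    formAlg_conv, conv_formAlg]
  module

theorem convPow_add_formAlg_three (Y : E →ₗ[ℂ] E →ₗ[ℂ] A) :
    S.convPow (Y + (2 : ℂ) • S.formAlg A) 3 =
      S.conv (S.conv Y Y) Y - (6 : ℂ) • S.conv Y Y + (12 : ℂ) • Y + (8 : ℂ) • S.formAlg A := by
  rw [convPow_three, ← convPow_two, convPow_add_formAlg_two]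
  simp only [map_add, map_sub, map_smul, LinearMap.sub_apply, LinearMap.smul_apply,
    formAlg_conv, conv_formAlg]
  module

end Convolution

section Howe

variable {n k : ℕ} {E F : Type*} [AddCommGroup E] [Module ℂ E] [AddCommGroup F] [Module ℂ F]
  {S : SymplecticFrame n E} {T : SymplecticFrame k F} {A : Type*} [Ring A] [Algebra ℂ A]

variable (S T) in
/-- The operators `Φ(f, u)` satisfy the canonical anticommutation relations of the symmetric form
`-τ ⊗ σ` on `F ⊗ E`. -/
def IsFermionic (Φ : F →ₗ[ℂ] E →ₗ[ℂ] A) : Prop :=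
  ∀ f g u v, Φ f u * Φ g v + Φ g v * Φ f u = -(T.form f g * S.form u v) • 1

variable (S) in
/-- The bilinear invariants `P(f, g) = ∑_μ sign(μ) Φ(f, ε_μ) Φ(g, ε_{-μ})` of `Sp(E)`. -/
def gram (Φ : F →ₗ[ℂ] E →ₗ[ℂ] A) : F →ₗ[ℂ] F →ₗ[ℂ] A :=
  S.conv Φ Φ.flip

theorem gram_apply (Φ : F →ₗ[ℂ] E →ₗ[ℂ] A) (f g : F) :
    S.gram Φ f g = S.contr fun a b => Φ f a * Φ g b :=
  S.conv_apply _ _ f g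

theorem gram_flip_conv_gram_flip (Φ : F →ₗ[ℂ] E →ₗ[ℂ] A) :
    S.conv (T.gram Φ.flip) (T.gram Φ.flip) = T.conv Φ.flip (T.conv (S.gram Φ) Φ) := by
  simp only [gram, LinearMap.flip_flip, conv_assoc]

theorem gram_flip_conv_gram_flip_conv_gram_flip (Φ : F →ₗ[ℂ] E →ₗ[ℂ] A) :
    S.conv (S.conv (T.gram Φ.flip) (T.gram Φ.flip)) (T.gram Φ.flip) =
      T.conv (T.conv Φ.flip (S.gram Φ)) (T.conv (S.gram Φ) Φ) := by
  simp only [gram, LinearMap.flip_flip, conv_assoc]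

namespace IsFermionic

variable {Φ : F →ₗ[ℂ] E →ₗ[ℂ] A} (hΦ : IsFermionic S T Φ)
include hΦ

protected theorem flip : IsFermionic T S Φ.flip := fun u v f g => by
  rw [mul_comm]
  exact hΦ f g u v

theorem mul_eq (f g : F) (u v : E) :
    Φ f u * Φ g v = -(Φ g v * Φ f u) - (T.form f g * S.form u v) • 1 := by
  rw [eq_sub_of_add_eq (hΦ f g u v), neg_smul]
  abel

theorem gram_mul (f g h : F) (v : E) : S.gram Φ f g * Φ h v =
    Φ h v * S.gram Φ f g + T.form f h • Φ g v + T.form g h • Φ f v := by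
  have hterm (a b : E) : Φ f a * Φ g b * Φ h v = Φ h v * (Φ f a * Φ g b) +
      T.form f h • (S.form a v • Φ g b) - T.form g h • (S.form b v • Φ f a) := by
    rw [mul_assoc, hΦ.mul_eq g h b v, mul_sub, mul_neg, ← mul_assoc, hΦ.mul_eq f h a v, sub_mul,
      neg_mul, mul_assoc]
    simp only [smul_mul_assoc, mul_smul_comm, one_mul, mul_one, mul_smul]
    abel
  simp only [gram_apply, contr_mul, mul_contr, hterm, contr_sub, contr_add, contr_smul,
    contr_form_left, contr_form_right]
  module

theorem commute_gram_gram_flip (f g : F) (u v : E) :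
    Commute (S.gram Φ f g) (T.gram Φ.flip u v) := by
  have hterm (a b : F) : S.gram Φ f g * (Φ a u * Φ b v) =
      Φ a u * Φ b v * S.gram Φ f g
        - T.form a f • (Φ g u * Φ b v) - T.form a g • (Φ f u * Φ b v)
        - T.form b f • (Φ a u * Φ g v) - T.form b g • (Φ a u * Φ f v) := by
    rw [← mul_assoc, hΦ.gram_mul, add_mul, add_mul, mul_assoc, hΦ.gram_mul, T.form_swap f a,
      T.form_swap g a, T.form_swap f b, T.form_swap g b]
    simp only [mul_add, smul_mul_assoc, mul_smul_comm, mul_assoc]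
    module
  have hleft (x : A) (h : F) : T.contr (fun a b => T.form a h • (x * Φ b v)) = x * Φ h v :=
    T.contr_form_left (LinearMap.mulLeft ℂ x ∘ₗ Φ.flip v) h
  have hright (x : A) (h : F) : T.contr (fun a b => T.form b h • (Φ a u * x)) = -(Φ h u * x) :=
    T.contr_form_right (LinearMap.mulRight ℂ x ∘ₗ Φ.flip u) h
  rw [commute_iff_eq, gram_apply (S := T), mul_contr, contr_mul]
  simp only [LinearMap.flip_apply, hterm, contr_sub, hleft, hright]
  abel

theorem gram_swap (f g : F) :
    S.gram Φ f g = S.gram Φ g f - (2 * n * T.form f g : ℂ) • 1 := by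
  simp only [gram_apply, hΦ.mul_eq f g, contr_sub, contr_neg]
  rw [S.contr_swap fun a b => Φ g a * Φ f b, neg_neg]
  simp only [mul_smul, contr_smul, contr_form_smul]
  module

theorem contr_gram : T.contr (fun f g => S.gram Φ f g) = -(2 * n * k : ℂ) • 1 := by
  have hswap : T.contr (fun f g => S.gram Φ f g) =
      -T.contr (fun f g => S.gram Φ f g) - (2 * n : ℂ) • (2 * k : ℂ) • 1 := calc
    _ = T.contr (fun f g => S.gram Φ g f - (2 * n : ℂ) • T.form f g • 1) :=
      congrArg T.contr (funext₂ fun f g => by rw [hΦ.gram_swap, mul_smul])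
    _ = _ := by rw [contr_sub, T.contr_swap fun f g => S.gram Φ f g, contr_smul, contr_form_smul]
  linear_combination (norm := module) (1 / 2 : ℂ) • hswap

theorem gram_conv (f : F) (v : E) : T.conv (S.gram Φ) Φ f v =
    T.contr (fun a b => Φ b v * S.gram Φ f a) + (2 * k + 1 : ℂ) • Φ f v := by
  have hright : T.contr (fun a b => T.form f b • Φ a v) = Φ f v := by
    simp only [T.form_swap f, neg_smul, contr_neg]
    exact neg_eq_iff_eq_neg.mpr (T.contr_form_right (Φ.flip v) f)
  simp only [conv_apply, hΦ.gram_mul, contr_add, hright, contr_form_smul]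
  module

theorem flip_conv_gram (u : E) (g : F) : T.conv Φ.flip (S.gram Φ) u g =
    T.contr (fun a b => S.gram Φ b g * Φ a u) + (2 * k + 1 : ℂ) • Φ g u := by
  have hterm (a b : F) : Φ a u * S.gram Φ b g =
      S.gram Φ b g * Φ a u + T.form a b • Φ g u + T.form a g • Φ b u := by
    rw [hΦ.gram_mul, T.form_swap a b, T.form_swap a g]
    module
  have hleft : T.contr (fun a b => T.form a g • Φ b u) = Φ g u :=
    T.contr_form_left (Φ.flip u) g
  simp only [conv_apply, LinearMap.flip_apply, hterm, contr_add, hleft, contr_form_smul]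
  module

theorem contr_gram_flip_conv_gram_flip :
    S.contr (fun u v => S.conv (T.gram Φ.flip) (T.gram Φ.flip) u v) +
      T.contr (fun f g => T.conv (S.gram Φ) (S.gram Φ) f g) =
        -(2 * n * k * (2 * n + 2 * k + 1) : ℂ) • 1 := by
  have hinner (a b : F) : S.contr (fun u v => Φ a u * T.conv (S.gram Φ) Φ b v) =
      -T.conv (S.gram Φ) (S.gram Φ) a b + (2 * n + 2 * k + 1 : ℂ) • S.gram Φ a b := by
    have hexpand (c d : F) : S.contr (fun u v => Φ a u * (Φ d v * S.gram Φ b c)) =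
        S.gram Φ a d * S.gram Φ c b + (2 * n : ℂ) • T.form c b • S.gram Φ a d := by
      simp only [← mul_assoc, ← contr_mul, ← gram_apply]
      rw [hΦ.gram_swap b c, mul_sub, mul_smul_comm, mul_one, T.form_swap b c]
      module
    simp only [hΦ.gram_conv, mul_add, contr_add, mul_contr, mul_smul_comm, contr_smul,
      ← gram_apply]
    rw [S.contr_comm T]
    simp only [hexpand, contr_add, contr_smul, T.contr_form_left (S.gram Φ a)]
    rw [T.contr_swap fun d c => S.gram Φ a d * S.gram Φ c b, ← conv_apply]
    module
  rw [gram_flip_conv_gram_flip]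
  simp only [conv_apply T Φ.flip, LinearMap.flip_apply]
  rw [S.contr_comm T]
  simp only [hinner, contr_add, contr_neg, contr_smul, hΦ.contr_gram]
  module

end IsFermionic

end Howe

section Anticommuting

variable {n : ℕ} {A : Type*} [Ring A] [Algebra ℂ A] {v : SymIdx n → A}

theorem mul_self_eq_zero_of_anticomm (hv : ∀ i j, v i * v j = -(v j * v i)) (i : SymIdx n) :
    v i * v i = 0 := by
  linear_combination (norm := module) (1 / 2 : ℂ) • hv i i

theorem mul_pair_eq_zero_of_anticomm (hv : ∀ i j, v i * v j = -(v j * v i)) (p : Fin n) (s : ℤˣ) :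
    v (p, s) * (v (p, 1) * v (p, -1)) = 0 := by
  rcases Int.units_eq_one_or s with rfl | rfl
  · rw [← mul_assoc, mul_self_eq_zero_of_anticomm hv, zero_mul]
  · rw [← mul_assoc, hv (p, -1), neg_mul, mul_assoc, mul_self_eq_zero_of_anticomm hv,
      mul_zero, neg_zero]

theorem mul_eq_smul_pair_of_anticomm (hv : ∀ i j, v i * v j = -(v j * v i)) (p : Fin n)
    (s t : ℤˣ) :
    v (p, s) * v (p, t) = (if s = -t then (s : ℂ) else 0) • (v (p, 1) * v (p, -1)) := by
  rcases Int.units_eq_one_or s with rfl | rfl <;> rcases Int.units_eq_one_or t with rfl | rfl <;>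
    simp [mul_self_eq_zero_of_anticomm hv, hv (p, -1) (p, 1)]

theorem sum_sgn_smul_mul_opp_of_anticomm (hv : ∀ i j, v i * v j = -(v j * v i)) :
    ∑ i : SymIdx n, i.sgn • (v i * v i.opp) = (2 : ℂ) • ∑ p, v (p, 1) * v (p, -1) := by
  rw [Fintype.sum_prod_type, Finset.smul_sum]
  refine Finset.sum_congr rfl fun p _ => ?_
  rw [UnitsInt.univ, Finset.sum_pair (by decide)]
  simp only [SymIdx.sgn, SymIdx.opp, neg_neg, hv (p, -1) (p, 1), Units.val_one, Units.val_neg,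
    Int.cast_one, Int.cast_neg]
  module

theorem mul_mul_sum_of_anticomm {v : SymIdx 2 → A} (hv : ∀ i j, v i * v j = -(v j * v i))
    (i j : SymIdx 2) : v i * v j * ∑ p, v (p, 1) * v (p, -1) =
      (if i = j.opp then i.sgn else 0 : ℂ) • (v (0, 1) * v (0, -1) * (v (1, 1) * v (1, -1))) := by
  let y : Fin 2 → A := fun p => v (p, 1) * v (p, -1)
  have hcomm (i : SymIdx 2) (p : Fin 2) : v i * y p = y p * v i := by
    rw [← mul_assoc, hv i, neg_mul, mul_assoc, hv i, mul_neg, neg_neg, mul_assoc]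
  have hkill (p : Fin 2) (s : ℤˣ) : v (p, s) * y p = 0 := mul_pair_eq_zero_of_anticomm hv p s
  change _ * ∑ p, y p = _ • (y 0 * y 1)
  obtain ⟨p, s⟩ := i
  obtain ⟨r, t⟩ := j
  by_cases hpr : p = r
  · subst hpr
    have hsq : y p * y p = 0 := by
      rw [show y p * y p = v (p, 1) * (v (p, -1) * y p) from mul_assoc _ _ _, hkill, mul_zero]
    have hprod : y p * ∑ r, y r = y 0 * y 1 := by
      have hyy : y 1 * y 0 = y 0 * y 1 := by
        rw [show y 1 * y 0 = v (1, 1) * (v (1, -1) * y 0) from mul_assoc _ _ _, hcomm,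
          ← mul_assoc, hcomm, mul_assoc]
      fin_cases p <;> simp_all [mul_add]
    rw [mul_eq_smul_pair_of_anticomm hv, smul_mul_assoc, hprod]
    simp [SymIdx.opp, SymIdx.sgn]
  · have hsum : ∑ r, y r = y p + y r := by
      rw [Fin.sum_univ_two]
      fin_cases p <;> fin_cases r <;> first | exact absurd rfl hpr | rfl | exact add_comm _ _
    rw [if_neg (by simp [SymIdx.opp, hpr]), zero_smul, hsum, mul_add, mul_assoc, mul_assoc, hkill,
      hcomm, ← mul_assoc, hkill, zero_mul, mul_zero, add_zero]

end Anticommuting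

section TopDegree

variable {F A : Type*} [AddCommGroup F] [Module ℂ F] [Ring A] [Algebra ℂ A]
  {T : SymplecticFrame 2 F}

theorem mul_mul_contr_of_anticomm (φ : F →ₗ[ℂ] A) (hφ : ∀ f g, φ f * φ g = -(φ g * φ f)) (f g : F) :
    φ f * φ g * T.contr (fun a b => φ a * φ b) =
      T.form f g • ((1 / 4 : ℂ) •
        (T.contr (fun a b => φ a * φ b) * T.contr fun a b => φ a * φ b)) := by
  set q := T.contr fun a b => φ a * φ b
  let v (i : SymIdx 2) : A := φ (T.frame i)
  have hv (i j : SymIdx 2) : v i * v j = -(v j * v i) := hφ _ _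
  have hqv : q = (2 : ℂ) • ∑ p, v (p, 1) * v (p, -1) := sum_sgn_smul_mul_opp_of_anticomm hv
  let top : A := v (0, 1) * v (0, -1) * (v (1, 1) * v (1, -1))
  have hvvq (i j : SymIdx 2) : v i * v j * q = (2 * if i = j.opp then i.sgn else 0 : ℂ) • top := by
    rw [hqv, mul_smul_comm, mul_mul_sum_of_anticomm hv, smul_smul]
  have hqq : q * q = (8 : ℂ) • top := by
    conv_lhs => lhs; rw [hqv]
    rw [smul_mul_assoc, Finset.sum_mul, Fin.sum_univ_two, hvvq, hvvq]
    simp only [SymIdx.opp, SymIdx.sgn, neg_neg, if_true, Units.val_one, Int.cast_one]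
    module
  have hbilin : ((LinearMap.mul ℂ A).compl₁₂ φ φ).compr₂ (LinearMap.mulRight ℂ q) =
      T.form.compr₂ (LinearMap.toSpanSingleton ℂ A ((1 / 4 : ℂ) • (q * q))) := by
    refine LinearMap.ext_basis T.frame T.frame fun i j => ?_
    change v i * v j * q = T.form (T.frame i) (T.frame j) • (1 / 4 : ℂ) • (q * q)
    rw [hqq, hvvq, T.form_frame]
    module
  exact LinearMap.congr_fun₂ hbilin f g

end TopDegree

namespace IsFermionic

variable {n : ℕ} {E F A : Type*} [AddCommGroup E] [Module ℂ E] [AddCommGroup F] [Module ℂ F]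
  [Ring A] [Algebra ℂ A] {S : SymplecticFrame n E} {T : SymplecticFrame 2 F}
  {Φ : F →ₗ[ℂ] E →ₗ[ℂ] A} (hΦ : IsFermionic S T Φ)
include hΦ

theorem mul_mul_gram_flip_self (w : E) (f g : F) : Φ f w * Φ g w * T.gram Φ.flip w w =
    T.form f g • ((1 / 4 : ℂ) • (T.gram Φ.flip w w * T.gram Φ.flip w w)) := by
  have hanti (f g : F) : Φ f w * Φ g w = -(Φ g w * Φ f w) := by
    rw [hΦ.mul_eq, S.alt w, mul_zero, zero_smul, sub_zero]
  simpa only [gram_apply, LinearMap.flip_apply] using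
    mul_mul_contr_of_anticomm (T := T) (Φ.flip w) hanti f g

theorem contr_mul_mul_gram_flip_self (w : E) (f : F) (g : F →ₗ[ℂ] A) :
    T.contr (fun a b => Φ f w * Φ b w * T.gram Φ.flip w w * g a) =
      (1 / 4 : ℂ) • (T.gram Φ.flip w w * T.gram Φ.flip w w * g f) := by
  simp only [hΦ.mul_mul_gram_flip_self, T.form_swap f, neg_smul, neg_mul, contr_neg,
    smul_mul_assoc]
  exact neg_eq_iff_eq_neg.mpr <| T.contr_form_right ((1 / 4 : ℂ) •
    (LinearMap.mulLeft ℂ (T.gram Φ.flip w w * T.gram Φ.flip w w) ∘ₗ g)) f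

theorem mul_gram_conv_mul_gram_flip_self (w : E) (f g : F) :
    Φ f w * T.conv (S.gram Φ) Φ g w * T.gram Φ.flip w w =
      (1 / 4 : ℂ) • (T.gram Φ.flip w w * T.gram Φ.flip w w *
        (S.gram Φ g f + (5 * T.form f g : ℂ) • 1)) := by
  have hcomm (a : F) : S.gram Φ g a * T.gram Φ.flip w w = T.gram Φ.flip w w * S.gram Φ g a :=
    (hΦ.commute_gram_gram_flip g a w w).eq
  have hcontr := hΦ.contr_mul_mul_gram_flip_self w f (S.gram Φ g)
  simp only [mul_assoc, ← hcomm] at hcontr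
  rw [hΦ.gram_conv, mul_add, add_mul, mul_contr, contr_mul]
  simp only [mul_smul_comm, smul_mul_assoc, mul_assoc, hcontr]
  rw [← mul_assoc (Φ f w), hΦ.mul_mul_gram_flip_self, hcomm]
  simp only [mul_add, mul_smul_comm, mul_one]
  push_cast
  module

theorem contr_gram_swap : T.contr (fun f g => S.gram Φ g f) = (4 * n : ℂ) • 1 := by
  rw [T.contr_swap fun f g => S.gram Φ f g, hΦ.contr_gram]
  push_cast
  module

theorem gram_flip_sq_mul_gram_flip_self (w : E) :
    S.conv (T.gram Φ.flip) (T.gram Φ.flip) w w * T.gram Φ.flip w w =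
      (n + 5 : ℂ) • (T.gram Φ.flip w w * T.gram Φ.flip w w) := by
  rw [gram_flip_conv_gram_flip, conv_apply, contr_mul]
  simp only [LinearMap.flip_apply, hΦ.mul_gram_conv_mul_gram_flip_self, contr_smul, ← mul_contr,
    contr_add, mul_smul, contr_form_smul, hΦ.contr_gram_swap, mul_add, mul_smul_comm, mul_one]
  push_cast
  module

theorem gram_flip_cube_mul_gram_flip_self (w : E) :
    S.conv (S.conv (T.gram Φ.flip) (T.gram Φ.flip)) (T.gram Φ.flip) w w * T.gram Φ.flip w w =
      (1 / 4 : ℂ) • (T.gram Φ.flip w w * T.gram Φ.flip w w * ((40 * n + 100 : ℂ) • 1 -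
        T.contr fun f g => T.conv (S.gram Φ) (S.gram Φ) f g)) := by
  set q := T.gram Φ.flip w w
  have hcomm (a b : F) (x : A) : S.gram Φ a b * (q * q * x) = q * q * (S.gram Φ a b * x) :=
    ((hΦ.commute_gram_gram_flip a b w w).mul_right (hΦ.commute_gram_gram_flip a b w w)).left_comm x
  have hmul (f g : F) : Φ f w * T.conv (S.gram Φ) Φ g w * q =
      (1 / 4 : ℂ) • (q * q * (S.gram Φ g f + (5 * T.form f g : ℂ) • 1)) :=
    hΦ.mul_gram_conv_mul_gram_flip_self w f g
  have hterm (a b : F) : T.conv Φ.flip (S.gram Φ) w a * T.conv (S.gram Φ) Φ b w * q =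
      (1 / 4 : ℂ) • (q * q * (T.contr (fun c d => S.gram Φ d a * S.gram Φ b c) +
        (10 : ℂ) • S.gram Φ b a + (25 : ℂ) • T.form a b • 1)) := by
    have hleft : T.contr (fun c d => T.form c b • S.gram Φ d a) = S.gram Φ b a :=
      T.contr_form_left ((S.gram Φ).flip a) b
    rw [hΦ.flip_conv_gram, mul_assoc, add_mul, contr_mul]
    simp only [mul_assoc (S.gram Φ _ _), smul_mul_assoc, ← mul_assoc (Φ _ _), hmul]
    simp only [mul_smul_comm, hcomm, contr_smul, ← mul_contr]
    simp only [mul_add, mul_smul_comm, mul_one, contr_add, mul_smul, contr_smul, hleft]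
    push_cast
    module
  have hcontr : T.contr (fun a b => T.contr fun c d => S.gram Φ d a * S.gram Φ b c) =
      -T.contr fun f g => T.conv (S.gram Φ) (S.gram Φ) f g := by
    rw [T.contr_comm T]
    simp only [← conv_apply]
    exact T.contr_swap fun f g => T.conv (S.gram Φ) (S.gram Φ) f g
  rw [gram_flip_conv_gram_flip_conv_gram_flip, conv_apply, contr_mul]
  simp only [hterm, contr_smul, ← mul_contr, contr_add, contr_form_smul, hΦ.contr_gram_swap,
    hcontr]
  congr 2
  push_cast
  module

theorem commute_contr_gram_conv_gram_gram_flip (u v : E) :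
    Commute (T.contr fun f g => T.conv (S.gram Φ) (S.gram Φ) f g) (T.gram Φ.flip u v) := by
  have hcomm (f g h i : F) : S.gram Φ f g * S.gram Φ h i * T.gram Φ.flip u v =
      T.gram Φ.flip u v * (S.gram Φ f g * S.gram Φ h i) :=
    ((hΦ.commute_gram_gram_flip f g u v).mul_left (hΦ.commute_gram_gram_flip h i u v)).eq
  simp only [commute_iff_eq, conv_apply, contr_mul, mul_contr, hcomm]

theorem convPow_three_mul_self {X : E →ₗ[ℂ] E →ₗ[ℂ] A}
    (hX : X = T.gram Φ.flip + (2 : ℂ) • S.formAlg A) (w : E) :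
    S.convPow X 3 w w * X w w =
      ((2 * n ^ 2 + 7 * n + 7 : ℂ) • 1 + (1 / 4 : ℂ) • S.contr fun u v => S.convPow X 2 u v) *
        (X w w * X w w) := by
  have hXw : X w w = T.gram Φ.flip w w := by
    simp only [hX, LinearMap.add_apply, LinearMap.smul_apply, formAlg_self, smul_zero, add_zero]
  have hcube : S.convPow X 3 w w =
      S.conv (S.conv (T.gram Φ.flip) (T.gram Φ.flip)) (T.gram Φ.flip) w w -
        (6 : ℂ) • S.conv (T.gram Φ.flip) (T.gram Φ.flip) w w + (12 : ℂ) • T.gram Φ.flip w w := by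
    simp only [hX, convPow_add_formAlg_three, LinearMap.add_apply, LinearMap.sub_apply,
      LinearMap.smul_apply, formAlg_self, smul_zero, add_zero]
  have hcas : S.contr (fun u v => S.convPow X 2 u v) = -(8 * n ^ 2 + 12 * n : ℂ) • 1 -
      T.contr fun f g => T.conv (S.gram Φ) (S.gram Φ) f g := by
    have hsum := hΦ.contr_gram_flip_conv_gram_flip
    simp only [hX, convPow_add_formAlg_two, LinearMap.sub_apply, LinearMap.smul_apply, contr_sub,
      contr_smul, contr_formAlg, hΦ.flip.contr_gram, eq_sub_of_add_eq hsum]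
    push_cast
    module
  have hcomm := hΦ.commute_contr_gram_conv_gram_gram_flip w w
  have hcomm := (hcomm.mul_right hcomm).eq
  rw [hcube, hcas, hXw, add_mul, sub_mul, smul_mul_assoc, smul_mul_assoc,
    hΦ.gram_flip_cube_mul_gram_flip_self, hΦ.gram_flip_sq_mul_gram_flip_self]
  simp only [mul_sub, sub_mul, add_mul, smul_sub, smul_mul_assoc, one_mul, hcomm, mul_smul_comm,
    mul_one]
  module

end IsFermionic

section Representation

variable {n : ℕ} {E : Type*} [AddCommGroup E] [Module ℂ E] (S : SymplecticFrame n E)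

/-- The product `u ⊙ v` as a bilinear map. -/
def odotBilin : E →ₗ[ℂ] E →ₗ[ℂ] S.sp :=
  LinearMap.mk₂ ℂ S.odot
    (fun u u' v => Subtype.ext <| LinearMap.ext fun w => by simp [odot]; module)
    (fun c u v => Subtype.ext <| LinearMap.ext fun w => by simp [odot]; module)
    (fun u v v' => Subtype.ext <| LinearMap.ext fun w => by simp [odot]; module)
    (fun c u v => Subtype.ext <| LinearMap.ext fun w => by simp [odot]; module)

theorem form_sp_apply (y : S.sp) (u v : E) :
    S.form ((y : Module.End ℂ E) u) v = -S.form u ((y : Module.End ℂ E) v) :=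
  y.2 u v

theorem sp_eq_contr_odot (y : S.sp) : y = (1 / 2 : ℂ) • S.contr fun a b =>
    S.contr fun c d => S.form ((y : Module.End ℂ E) b) d • S.odot a c := by
  refine Subtype.ext (LinearMap.ext fun w => ?_)
  let eval : S.sp →ₗ[ℂ] E := LinearMap.applyₗ w ∘ₗ S.sp.toSubmodule.subtype
  have heval (u v : E) : eval (S.odot u v) = S.form u w • v + S.form v w • u := rfl
  have hfst (b : E) : S.contr (fun c d => S.form (y.1 b) d • c) = y.1 b := by
    simp only [S.form_swap (y.1 b), neg_smul, contr_neg]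
    exact neg_eq_iff_eq_neg.mpr (S.contr_form_right LinearMap.id _)
  have hsnd (a b : E) : S.contr (fun c d => S.form c w • S.form (y.1 b) d • a) =
      -(S.form b (y.1 w) • a) := by
    rw [← neg_smul, ← S.form_sp_apply]
    exact S.contr_form_left ((S.form (y.1 b)).smulRight a) w
  have hright : S.contr (fun a b => S.form b (y.1 w) • a) = -y.1 w :=
    S.contr_form_right LinearMap.id _
  have heval_contr : eval (S.contr fun a b => S.contr fun c d => S.form (y.1 b) d • S.odot a c) =
      S.contr (fun a b => S.form a w • y.1 b) - S.contr fun a b => S.form b (y.1 w) • a := by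
    simp only [map_contr, map_smul, heval, smul_add, contr_add, hsnd, contr_neg,
      smul_comm _ (S.form _ w), contr_smul, hfst, sub_eq_add_neg]
  rw [S.contr_form_left y.1, hright] at heval_contr
  calc y.1 w = (1 / 2 : ℂ) • (y.1 w - -y.1 w) := by module
    _ = (1 / 2 : ℂ) • eval (S.contr fun a b => S.contr fun c d => S.form (y.1 b) d • S.odot a c) :=
      congrArg _ heval_contr.symm

variable (V : Type*) [AddCommGroup V] [Module ℂ V] [LieRingModule S.sp V] [LieModule ℂ S.sp V]

/-- The action `u, v ↦ π(u ⊙ v)` on a representation of `sp(n, ℂ)`. -/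
def odotEnd : E →ₗ[ℂ] E →ₗ[ℂ] Module.End ℂ V :=
  S.odotBilin.compr₂ (LieModule.toEnd ℂ S.sp V)

theorem odotEnd_apply (u v : E) : S.odotEnd V u v = LieModule.toEnd ℂ S.sp V (S.odot u v) := rfl

theorem rep_ι (y : S.sp) :
    S.rep V (UniversalEnvelopingAlgebra.ι ℂ y) = LieModule.toEnd ℂ S.sp V y :=
  UniversalEnvelopingAlgebra.lift_ι_apply ℂ _ y

theorem toEnd_eq_contr_odotEnd (y : S.sp) : LieModule.toEnd ℂ S.sp V y =
    (1 / 2 : ℂ) • S.contr fun a b => S.contr fun c d =>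
      S.form ((y : Module.End ℂ E) b) d • S.odotEnd V a c := by
  have hmap (B : E → E → S.sp) := S.map_contr (LieModule.toEnd ℂ S.sp V).toLinearMap B
  simp only [LieHom.coe_toLinearMap] at hmap
  conv_lhs => rw [S.sp_eq_contr_odot y]
  simp only [map_smul, hmap, odotEnd_apply]

theorem rep_xMatrix_pow (q : ℕ) (α β : SymIdx n) : S.rep V ((S.xMatrix ^ q) α β) =
    (-β.sgn) • S.convPow (S.odotEnd V) q (S.frame α) (S.frame β.opp) := by
  induction q generalizing β with
  | zero =>
    rw [pow_zero, convPow, LinearMap.neg_apply, LinearMap.neg_apply, formAlg_apply, S.form_frame,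
      SymIdx.opp_opp, Matrix.one_apply, neg_smul_neg, smul_smul]
    split_ifs with h
    · rw [h, SymIdx.sgn_mul_sgn, one_smul, map_one]
    · rw [mul_zero, zero_smul, map_zero]
  | succ q ih =>
    have hx (γ : SymIdx n) : S.rep V (S.xMatrix γ β) =
        (-β.sgn) • S.odotEnd V (S.frame γ) (S.frame β.opp) := by
      rw [xMatrix, Matrix.of_apply, rep_ι, x, map_smul, odotEnd_apply]
    rw [pow_succ, Matrix.mul_apply, map_sum, convPow, conv_apply, contr, ← SymIdx.sum_opp,
      Finset.smul_sum]
    refine Finset.sum_congr rfl fun γ _ => ?_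
    rw [map_mul, ih, hx, SymIdx.opp_opp, SymIdx.sgn_opp, neg_neg, smul_mul_smul_comm, smul_smul,
      mul_comm]

theorem rep_casimir (q : ℕ) : S.rep V (S.casimir q) =
    -S.contr fun u v => S.convPow (S.odotEnd V) q u v := by
  simp only [casimir, map_sum, rep_xMatrix_pow, neg_smul, Finset.sum_neg_distrib, contr]

theorem curvEnd_eq_contr (R : E →ₗ[ℂ] E →ₗ[ℂ] S.sp) (q : ℕ) : S.curvEnd V R q =
    S.contr fun a a' => S.contr fun b b' =>
      S.convPow (S.odotEnd V) q a b * LieModule.toEnd ℂ S.sp V (R a' b') := by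
  simp only [curvEnd, curvElement, map_sum, map_smul, map_mul, rep_xMatrix_pow, rep_ι, contr,
    Finset.smul_sum]
  refine Finset.sum_congr rfl fun α _ => ?_
  rw [← SymIdx.sum_opp]
  simp only [SymIdx.opp_opp, SymIdx.sgn_opp, neg_neg, smul_mul_assoc]

end Representation

section Curvature

variable {n : ℕ} {E : Type*} [AddCommGroup E] [Module ℂ E] (S : SymplecticFrame n E)

/-- The components of `σ(R(u₁, u₂) u₃, u₄)` with all indices raised by means of `σ`. -/
def curvCoeff (R : E →ₗ[ℂ] E →ₗ[ℂ] S.sp) (i : Fin 4 → SymIdx n) : ℂ :=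
  (∏ j, (i j).sgn) * S.form
    ((R (S.frame (i 0).opp) (S.frame (i 1).opp) : Module.End ℂ E) (S.frame (i 2).opp))
    (S.frame (i 3).opp)

variable {S} in
theorem IsHyperCurvature.curvCoeff_comp {R : E →ₗ[ℂ] E →ₗ[ℂ] S.sp} (hR : S.IsHyperCurvature R)
    (i : Fin 4 → SymIdx n) (p : Equiv.Perm (Fin 4)) :
    S.curvCoeff R (i ∘ p) = S.curvCoeff R i :=
  congrArg₂ (· * ·) (Equiv.prod_comp p fun j => (i j).sgn) (hR (fun j => S.frame (i j).opp) p)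

variable (V : Type*) [AddCommGroup V] [Module ℂ V] [LieRingModule S.sp V] [LieModule ℂ S.sp V]

theorem curvEnd_eq_sum_curvCoeff (R : E →ₗ[ℂ] E →ₗ[ℂ] S.sp) (q : ℕ) : S.curvEnd V R q =
    (1 / 2 : ℂ) • ∑ i, S.curvCoeff R i •
      (S.convPow (S.odotEnd V) q (S.frame (i 0)) (S.frame (i 1)) *
        S.odotEnd V (S.frame (i 2)) (S.frame (i 3))) := by
  simp only [curvCoeff, Fin.prod_univ_four]
  rw [sum_fin_four fun α β γ δ => (α.sgn * β.sgn * γ.sgn * δ.sgn * S.form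
    ((R (S.frame α.opp) (S.frame β.opp) : Module.End ℂ E) (S.frame γ.opp)) (S.frame δ.opp)) •
    (S.convPow (S.odotEnd V) q (S.frame α) (S.frame β) * S.odotEnd V (S.frame γ) (S.frame δ))]
  simp only [curvEnd_eq_contr, toEnd_eq_contr_odotEnd, mul_smul_comm, contr_smul, mul_contr]
  simp only [contr, Finset.smul_sum, smul_smul, mul_assoc]

variable {V}

theorem curvEnd_three_of_convPow_mul_self (c : ℂ)
    (h : ∀ w, S.convPow (S.odotEnd V) 3 w w * S.odotEnd V w w =
      (c • 1 + (1 / 4 : ℂ) • S.contr fun u v => S.convPow (S.odotEnd V) 2 u v) *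
        (S.odotEnd V w w * S.odotEnd V w w))
    {R : E →ₗ[ℂ] E →ₗ[ℂ] S.sp} (hR : S.IsHyperCurvature R) :
    S.curvEnd V R 3 = (c • 1 - (1 / 4 : ℂ) • S.rep V (S.casimir 2)) * S.curvEnd V R 1 := by
  rw [rep_casimir, smul_neg, sub_neg_eq_add]
  set K := c • 1 + (1 / 4 : ℂ) • S.contr fun u v => S.convPow (S.odotEnd V) 2 u v
  have : IsAddTorsionFree (Module.End ℂ V) := .of_isTorsionFree ℂ _
  have hpol := sum_symm_smul_mul_eq_zero
    (S.convPow (S.odotEnd V) 3 - (S.odotEnd V).compr₂ (LinearMap.mulLeft ℂ K)) (S.odotEnd V)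
    (fun w => by
      rw [LinearMap.sub_apply, LinearMap.sub_apply, LinearMap.compr₂_apply,
        LinearMap.mulLeft_apply, sub_mul, h, mul_assoc, sub_self])
    S.frame (S.curvCoeff R) hR.curvCoeff_comp
  simp only [LinearMap.sub_apply, LinearMap.compr₂_apply, LinearMap.mulLeft_apply, sub_mul,
    smul_sub, Finset.sum_sub_distrib, sub_eq_zero] at hpol
  simp only [curvEnd_eq_sum_curvCoeff, hpol, convPow_one, mul_smul_comm, Finset.mul_sum, mul_assoc]

theorem curvEnd_one_eq_zero_of_odotEnd_mul_self
    (h : ∀ w, S.odotEnd V w w * S.odotEnd V w w = 0)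
    {R : E →ₗ[ℂ] E →ₗ[ℂ] S.sp} (hR : S.IsHyperCurvature R) : S.curvEnd V R 1 = 0 := by
  have : IsAddTorsionFree (Module.End ℂ V) := .of_isTorsionFree ℂ _
  rw [curvEnd_eq_sum_curvCoeff, convPow_one,
    sum_symm_smul_mul_eq_zero _ _ h S.frame _ hR.curvCoeff_comp, smul_zero]

variable {W : Type*} [AddCommGroup W] [Module ℂ W] [LieRingModule S.sp W] [LieModule ℂ S.sp W]

theorem map_rep (f : V →ₗ⁅ℂ,S.sp⁆ W) (z : S.Env) (v : V) :
    f (S.rep V z v) = S.rep W z (f v) := by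
  obtain ⟨t, rfl⟩ : ∃ t, UniversalEnvelopingAlgebra.mkAlgHom ℂ S.sp t = z := Quotient.exists_rep z
  induction t using TensorAlgebra.induction generalizing v with
  | algebraMap r => simp only [AlgHom.commutes, Module.algebraMap_end_apply, map_smul]
  | ι y => simp only [rep, UniversalEnvelopingAlgebra.lift_ι_apply', LieModule.toEnd_apply_apply,
      LieModuleHom.map_lie]
  | mul s t hs ht => simp only [map_mul, Module.End.mul_apply, hs, ht]
  | add s t hs ht => simp only [map_add, LinearMap.add_apply, hs, ht]

theorem rep_eq_zero_of_injective {f : V →ₗ⁅ℂ,S.sp⁆ W} (hf : Function.Injective f)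
    {z : S.Env} (h : S.rep W z = 0) : S.rep V z = 0 :=
  LinearMap.ext fun v => hf <| by
    rw [map_rep, h, LinearMap.zero_apply, LinearMap.zero_apply, map_zero]

end Curvature

section Exterior

variable {n : ℕ} {E : Type*} [AddCommGroup E] [Module ℂ E] (S : SymplecticFrame n E)

variable (E) in
/-- Exterior multiplication by a vector from the left. -/
def creation : E →ₗ[ℂ] Module.End ℂ (ExteriorAlgebra ℂ E) :=
  LinearMap.mul ℂ (ExteriorAlgebra ℂ E) ∘ₗ ExteriorAlgebra.ι ℂ

/-- The contraction of exterior forms with the linear form `σ(u, ·)`. -/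
def annihilation : E →ₗ[ℂ] Module.End ℂ (ExteriorAlgebra ℂ E) :=
  CliffordAlgebra.contractLeft (Q := (0 : QuadraticForm ℂ E)) ∘ₗ S.form

variable (E) in
/-- The parity operator of the exterior algebra, which anticommutes with the creation and
annihilation operators. -/
def parity : Module.End ℂ (ExteriorAlgebra ℂ E) :=
  (CliffordAlgebra.involute (Q := (0 : QuadraticForm ℂ E))).toLinearMap

theorem creation_apply (u : E) (x : ExteriorAlgebra ℂ E) :
    creation E u x = ExteriorAlgebra.ι ℂ u * x := rfl

theorem annihilation_algebraMap (u : E) (r : ℂ) :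
    S.annihilation u (algebraMap ℂ (ExteriorAlgebra ℂ E) r) = 0 :=
  CliffordAlgebra.contractLeft_algebraMap (0 : QuadraticForm ℂ E) (S.form u) r

theorem parity_algebraMap (r : ℂ) :
    parity E (algebraMap ℂ (ExteriorAlgebra ℂ E) r) = algebraMap ℂ (ExteriorAlgebra ℂ E) r :=
  AlgHom.commutes (CliffordAlgebra.involute (Q := (0 : QuadraticForm ℂ E))) r

theorem creation_mul_creation (u v : E) :
    creation E u * creation E v = -(creation E v * creation E u) := by
  refine LinearMap.ext fun x => eq_neg_of_add_eq_zero_left ?_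
  simp only [Module.End.mul_apply, creation_apply, ← mul_assoc, ← add_mul,
    ExteriorAlgebra.ι_add_mul_swap, zero_mul]

theorem annihilation_mul_annihilation (u v : E) :
    S.annihilation u * S.annihilation v = -(S.annihilation v * S.annihilation u) :=
  LinearMap.ext fun x => CliffordAlgebra.contractLeft_comm (S.form u) (S.form v) x

theorem annihilation_mul_creation (u v : E) :
    S.annihilation u * creation E v = S.form u v • 1 - creation E v * S.annihilation u :=
  LinearMap.ext fun x => CliffordAlgebra.contractLeft_ι_mul (S.form u) v x

theorem parity_mul_parity : parity E * parity E = 1 :=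
  LinearMap.ext CliffordAlgebra.involute_involute

theorem parity_mul_creation (u : E) : parity E * creation E u = -(creation E u * parity E) := by
  refine LinearMap.ext fun x => ?_
  change CliffordAlgebra.involute (CliffordAlgebra.ι 0 u * x) =
    -(CliffordAlgebra.ι 0 u * CliffordAlgebra.involute x)
  rw [map_mul, CliffordAlgebra.involute_ι, neg_mul]

theorem exterior_left_induction {P : ExteriorAlgebra ℂ E → Prop}
    (algebraMap : ∀ r : ℂ, P (algebraMap ℂ _ r)) (add : ∀ x y, P x → P y → P (x + y))
    (creation : ∀ x m, P x → P (creation E m x)) (x : ExteriorAlgebra ℂ E) : P x :=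
  CliffordAlgebra.left_induction (Q := (0 : QuadraticForm ℂ E)) algebraMap add creation x

theorem parity_mul_annihilation (u : E) :
    parity E * S.annihilation u = -(S.annihilation u * parity E) := by
  refine LinearMap.ext fun x => ?_
  induction x using exterior_left_induction with
  | algebraMap r => simp [annihilation_algebraMap, parity_algebraMap]
  | add x y hx hy => rw [map_add, map_add, hx, hy]
  | creation x m hx =>
    have hac (y : ExteriorAlgebra ℂ E) : S.annihilation u (creation E m y) =
        S.form u m • y - creation E m (S.annihilation u y) :=
      LinearMap.congr_fun (S.annihilation_mul_creation u m) y
    have hpc (y : ExteriorAlgebra ℂ E) :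
        parity E (creation E m y) = -creation E m (parity E y) :=
      LinearMap.congr_fun (parity_mul_creation m) y
    simp only [LinearMap.neg_apply, Module.End.mul_apply] at hx ⊢
    rw [hac, map_sub, map_smul, hpc, hpc, hx, map_neg, map_neg, hac]
    abel

theorem extDer_mul_creation (A : Module.End ℂ E) (m : E) :
    extDer A * creation E m = creation E (A m) + creation E m * extDer A :=
  LinearMap.ext fun x => (extDer_mul A _ x).trans <| by rw [extDer_ι]; rfl

theorem extDer_odot (u v : E) : extDer (S.odot u v : Module.End ℂ E) =
    creation E u * S.annihilation v + creation E v * S.annihilation u := by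
  refine LinearMap.ext fun x => ?_
  induction x using exterior_left_induction with
  | algebraMap r => simp [annihilation_algebraMap, extDer_algebraMap]
  | add x y hx hy => rw [map_add, map_add, hx, hy]
  | creation x m hx =>
    have hcomm (u v : E) : creation E u * S.annihilation v * creation E m =
        S.form v m • creation E u + creation E m * (creation E u * S.annihilation v) := by
      rw [mul_assoc, annihilation_mul_creation, mul_sub, ← mul_assoc, creation_mul_creation u m,
        mul_smul_comm, mul_one, neg_mul, sub_neg_eq_add, mul_assoc]
    have h : creation E (S.form u m • v + S.form v m • u) + creation E m *
        (creation E u * S.annihilation v + creation E v * S.annihilation u) =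
        (creation E u * S.annihilation v + creation E v * S.annihilation u) * creation E m := by
      rw [add_mul, hcomm, hcomm, map_add, map_smul, map_smul, mul_add]
      abel
    have hm := LinearMap.congr_fun (extDer_mul_creation (S.odot u v).1 m) x
    rw [Module.End.mul_apply, LinearMap.add_apply, Module.End.mul_apply, hx] at hm
    exact hm.trans (LinearMap.congr_fun h x)

theorem extDer_odot_self_mul_self (w : E) :
    extDer (S.odot w w : Module.End ℂ E) * extDer (S.odot w w : Module.End ℂ E) = 0 := by
  have : IsAddTorsionFree (Module.End ℂ (ExteriorAlgebra ℂ E)) := .of_isTorsionFree ℂ _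
  have hsq : creation E w * creation E w = 0 := self_eq_neg.mp (creation_mul_creation w w)
  have h : creation E w * S.annihilation w * (creation E w * S.annihilation w) = 0 := by
    rw [mul_assoc, ← mul_assoc (S.annihilation w), annihilation_mul_creation, S.alt w, zero_smul,
      zero_sub, neg_mul, mul_neg, mul_assoc, ← mul_assoc (creation E w), hsq, zero_mul, neg_zero]
  rw [extDer_odot, ← two_mul, mul_assoc, ← mul_assoc _ 2, ← (Commute.ofNat_left 2 _).eq, mul_assoc,
    h, mul_zero, mul_zero]

end Exterior

section StandardFrame

variable {n k : ℕ} {E : Type*} [AddCommGroup E] [Module ℂ E] {S : SymplecticFrame n E}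
  {A : Type*} [Ring A] [Algebra ℂ A]

/-- The standard symplectic form `∑_α sign(α) x_α y_{-α}` on `ℂ^{2k}` with its standard basis. -/
def standard (k : ℕ) : SymplecticFrame k (SymIdx k → ℂ) where
  form := ∑ α : SymIdx k,
    α.sgn • (LinearMap.mul ℂ ℂ).compl₁₂ (LinearMap.proj α) (LinearMap.proj α.opp)
  alt x := by
    refine self_eq_neg.mp ?_
    simp only [LinearMap.sum_apply, LinearMap.smul_apply, LinearMap.compl₁₂_apply]
    conv_lhs => rw [← SymIdx.sum_opp]
    rw [← Finset.sum_neg_distrib]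
    exact Finset.sum_congr rfl fun α _ => by simp [mul_comm]
  frame := Pi.basisFun ℂ (SymIdx k)
  form_frame α β := by
    simp only [LinearMap.sum_apply, LinearMap.smul_apply, LinearMap.compl₁₂_apply,
      Pi.basisFun_apply, LinearMap.proj_apply, LinearMap.mul_apply_apply]
    rw [Finset.sum_eq_single α (by intro b _ hb; simp [hb]) (by simp)]
    have hopp : α.opp = β ↔ α = β.opp :=
      ⟨fun h => by rw [← h, SymIdx.opp_opp], fun h => by rw [h, SymIdx.opp_opp]⟩
    simp [Pi.single_apply, hopp]

theorem isFermionic_constr {F : Type*} [AddCommGroup F] [Module ℂ F] {T : SymplecticFrame k F}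
    {φ : SymIdx k → E →ₗ[ℂ] A} (hφ : ∀ i j u v, φ i u * φ j v + φ j v * φ i u =
      -((if i = j.opp then i.sgn else 0) * S.form u v) • 1) :
    IsFermionic S T (T.frame.constr ℂ φ) := by
  intro f g u v
  set Φ := T.frame.constr ℂ φ
  have h : (LinearMap.mul ℂ A).compl₁₂ (Φ.flip u) (Φ.flip v) +
      ((LinearMap.mul ℂ A).compl₁₂ (Φ.flip v) (Φ.flip u)).flip =
      T.form.compr₂ (LinearMap.toSpanSingleton ℂ A (-S.form u v • 1)) := by
    refine T.frame.ext fun i => T.frame.ext fun j => ?_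
    have hi (l) : Φ (T.frame l) = φ l := T.frame.constr_basis ℂ φ l
    simp [hi, hφ, T.form_frame, smul_smul]
  simpa [smul_smul] using LinearMap.congr_fun₂ h f g

end StandardFrame

section Fock

variable {n : ℕ} {E : Type*} [AddCommGroup E] [Module ℂ E] (S : SymplecticFrame n E)

/-- The creation operators for the sign `1` and the annihilation operators for the sign `-1`. -/
def ladder (s : ℤˣ) : E →ₗ[ℂ] Module.End ℂ (ExteriorAlgebra ℂ E) :=
  if s = 1 then creation E else S.annihilation

theorem ladder_one : S.ladder 1 = creation E := rfl

theorem ladder_neg_one : S.ladder (-1) = S.annihilation := rfl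

theorem ladder_anticomm (s t : ℤˣ) (u v : E) :
    S.ladder s u * S.ladder t v + S.ladder t v * S.ladder s u =
      (-((if s = -t then ((s : ℤ) : ℂ) else 0) * S.form u v)) • 1 := by
  rcases Int.units_eq_one_or s with rfl | rfl <;> rcases Int.units_eq_one_or t with rfl | rfl
  · simp [ladder_one, creation_mul_creation u v]
  · simp [ladder_one, ladder_neg_one, annihilation_mul_creation, S.form_swap v u]
  · simp [ladder_one, ladder_neg_one, annihilation_mul_creation]
  · simp [ladder_neg_one, S.annihilation_mul_annihilation u v]

theorem parity_mul_ladder (s : ℤˣ) (u : E) :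
    parity E * S.ladder s u = -(S.ladder s u * parity E) := by
  rcases Int.units_eq_one_or s with rfl | rfl
  exacts [parity_mul_creation u, S.parity_mul_annihilation u]

/-- The ladder operators of the two factors of `Λ(E) ⊗ Λ(E)`. Those of the second factor are
twisted by the parity of the first in order that they anticommute with those of the first. -/
def pairModes (i : SymIdx 2) :
    E →ₗ[ℂ] Module.End ℂ (ExteriorAlgebra ℂ E ⊗[ℂ] ExteriorAlgebra ℂ E) :=
  ![LinearMap.rTensorHom _, LinearMap.mulLeft ℂ ((parity E).rTensor _) ∘ₗ LinearMap.lTensorHom _]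
    i.1 ∘ₗ S.ladder i.2

theorem pairModes_zero (s : ℤˣ) (u : E) :
    S.pairModes (0, s) u = TensorProduct.map (S.ladder s u) 1 := rfl

theorem pairModes_one (s : ℤˣ) (u : E) :
    S.pairModes (1, s) u = TensorProduct.map (parity E) (S.ladder s u) :=
  LinearMap.rTensor_comp_lTensor _ _ _

theorem pairModes_anticomm (i j : SymIdx 2) (u v : E) :
    S.pairModes i u * S.pairModes j v + S.pairModes j v * S.pairModes i u =
      -((if i = j.opp then i.sgn else 0) * S.form u v) • 1 := by
  obtain ⟨p, s⟩ := i
  obtain ⟨q, t⟩ := j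
  fin_cases p <;> fin_cases q
  · simp only [Fin.zero_eta, pairModes_zero, ← TensorProduct.map_mul, mul_one,
      ← TensorProduct.map_add_left, ladder_anticomm, TensorProduct.map_smul_left,
      TensorProduct.map_one, SymIdx.opp, SymIdx.sgn, Prod.mk.injEq, true_and]
  · simp [pairModes_zero, pairModes_one, ← TensorProduct.map_mul, parity_mul_ladder,
      ← TensorProduct.map_add_left, SymIdx.opp]
  · simp [pairModes_zero, pairModes_one, ← TensorProduct.map_mul, parity_mul_ladder,
      ← TensorProduct.map_add_left, SymIdx.opp]
  · simp only [Fin.mk_one, pairModes_one, ← TensorProduct.map_mul, parity_mul_parity,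
      ← TensorProduct.map_add_right, ladder_anticomm, TensorProduct.map_smul_right,
      TensorProduct.map_one, SymIdx.opp, SymIdx.sgn, Prod.mk.injEq, true_and]

/-- The two families of fermions on `Λ(E) ⊗ Λ(E)` as one family indexed by `ℂ⁴`. -/
def pairFermions :
    (SymIdx 2 → ℂ) →ₗ[ℂ] E →ₗ[ℂ] Module.End ℂ (ExteriorAlgebra ℂ E ⊗[ℂ] ExteriorAlgebra ℂ E) :=
  (standard 2).frame.constr ℂ S.pairModes

theorem isFermionic_pairFermions : IsFermionic S (standard 2) S.pairFermions :=
  isFermionic_constr S.pairModes_anticomm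

/-- `End(E)`, hence each of its Lie subalgebras, acts on `Λ(E)` by derivations. -/
instance : LieRingModule (Module.End ℂ E) (ExteriorAlgebra ℂ E) where
  bracket A ω := extDer A ω
  add_lie A B ω := by rw [extDer_add]; rfl
  lie_add A := map_add (extDer A)
  leibniz_lie A B ω := by rw [extDer_lie]; exact (sub_add_cancel _ _).symm

instance : LieModule ℂ (Module.End ℂ E) (ExteriorAlgebra ℂ E) where
  smul_lie c A ω := by exact LinearMap.congr_fun (extDer_smul c A) ω
  lie_smul c A := map_smul (extDer A) c

theorem gram_flip_pairFermions (u v : E) : (standard 2).gram S.pairFermions.flip u v =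
    S.pairModes (0, 1) u * S.pairModes (0, -1) v - S.pairModes (0, -1) u * S.pairModes (0, 1) v
      + (S.pairModes (1, 1) u * S.pairModes (1, -1) v
      - S.pairModes (1, -1) u * S.pairModes (1, 1) v) := by
  have hmodes (i) : S.pairFermions ((standard 2).frame i) = S.pairModes i :=
    (standard 2).frame.constr_basis ℂ S.pairModes i
  simp [gram_apply, contr, hmodes, Fintype.sum_prod_type, UnitsInt.univ, SymIdx.opp, SymIdx.sgn,
    sub_eq_add_neg]

theorem odotEnd_exterior_tensor_exterior :
    S.odotEnd (ExteriorAlgebra ℂ E ⊗[ℂ] ExteriorAlgebra ℂ E) =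
      (standard 2).gram S.pairFermions.flip + (2 : ℂ) • S.formAlg _ := by
  ext1 u
  ext1 v
  have hladder : extDer (S.odot u v).1 = S.ladder 1 u * S.ladder (-1) v -
      S.ladder (-1) u * S.ladder 1 v + S.form u v • 1 := by
    rw [extDer_odot, ladder_one, ladder_neg_one, annihilation_mul_creation]
    abel
  change TensorProduct.map (extDer (S.odot u v).1) 1 + TensorProduct.map 1 (extDer (S.odot u v).1) =
    (standard 2).gram S.pairFermions.flip u v + (2 : ℂ) • S.formAlg _ u v
  simp only [gram_flip_pairFermions, hladder, formAlg_apply, pairModes_zero, pairModes_one,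
    ← TensorProduct.map_mul, parity_mul_parity, mul_one, sub_eq_add_neg,
    TensorProduct.map_add_left, TensorProduct.map_add_right, TensorProduct.map_smul_left,
    TensorProduct.map_smul_right, TensorProduct.map_one, ← neg_one_smul ℂ (_ * _ : Module.End ℂ _)]
  module

end Fock

section ExteriorPowers

variable {n : ℕ} {E : Type*} [AddCommGroup E] [Module ℂ E] (S : SymplecticFrame n E)
  {R : E →ₗ[ℂ] E →ₗ[ℂ] S.sp} (hR : S.IsHyperCurvature R)

/-- The inclusion of `Λ^a(E)` into `Λ(E)` as a morphism of `sp(n, ℂ)`-modules. -/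
def extPowerIncl (a : ℕ) : ExtPower E a →ₗ⁅ℂ,S.sp⁆ ExteriorAlgebra ℂ E where
  __ := ExtPower.incl E a
  map_lie' := rfl

theorem map_extPowerIncl_injective (a b : ℕ) : Function.Injective
    (TensorProduct.LieModule.map (S.extPowerIncl a) (S.extPowerIncl b)) :=
  TensorProduct.map_injective_of_flat_flat (ExtPower.incl E a) (ExtPower.incl E b)
    (ExtPower.incl_injective a) (ExtPower.incl_injective b)

theorem odotEnd_extPower_self_mul_self (a : ℕ) (w : E) :
    S.odotEnd (ExtPower E a) w w * S.odotEnd (ExtPower E a) w w = 0 :=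
  LinearMap.ext fun ω => ExtPower.incl_injective a
    (LinearMap.congr_fun (S.extDer_odot_self_mul_self w) (ExtPower.incl E a ω))

instance : LieModule.IsTrivial S.sp (ExtPower E 0) where
  trivial A ω := by
    obtain ⟨r, hr⟩ : ∃ r, algebraMap ℂ _ r = ExtPower.incl E 0 ω := by
      rw [← Submodule.mem_one, ← pow_zero]
      exact ω.2
    refine ExtPower.incl_injective 0 ?_
    change extDer A.1 (ExtPower.incl E 0 ω) = ExtPower.incl E 0 0
    rw [← hr, extDer_algebraMap, map_zero]

theorem odotEnd_tensor_of_isTrivial (V W : Type*) [AddCommGroup V] [Module ℂ V]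
    [LieRingModule S.sp V] [LieModule ℂ S.sp V] [AddCommGroup W] [Module ℂ W]
    [LieRingModule S.sp W] [LieModule ℂ S.sp W] [LieModule.IsTrivial S.sp W] (u v : E) :
    S.odotEnd (V ⊗[ℂ] W) u v = (S.odotEnd V u v).rTensor W := by
  ext x y
  simp [odotEnd_apply, trivial_lie_zero S.sp W]

include hR

theorem curvEnd_exterior_tensor_exterior_three :
    S.curvEnd (ExteriorAlgebra ℂ E ⊗[ℂ] ExteriorAlgebra ℂ E) R 3 =
      ((2 * (n : ℂ) ^ 2 + 7 * n + 7) • 1 - (1 / 4 : ℂ) • S.rep _ (S.casimir 2)) *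
        S.curvEnd (ExteriorAlgebra ℂ E ⊗[ℂ] ExteriorAlgebra ℂ E) R 1 :=
  S.curvEnd_three_of_convPow_mul_self _
    (S.isFermionic_pairFermions.convPow_three_mul_self S.odotEnd_exterior_tensor_exterior) hR

theorem curvEnd_extPower_one (a : ℕ) : S.curvEnd (ExtPower E a) R 1 = 0 :=
  S.curvEnd_one_eq_zero_of_odotEnd_mul_self (S.odotEnd_extPower_self_mul_self a) hR

theorem curvEnd_extPower_tensor_extPower_zero_one (a : ℕ) :
    S.curvEnd (ExtPower E a ⊗[ℂ] ExtPower E 0) R 1 = 0 := by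
  refine S.curvEnd_one_eq_zero_of_odotEnd_mul_self (fun w => ?_) hR
  have hw : S.odotEnd (ExtPower E a ⊗[ℂ] ExtPower E 0) w w =
      (S.odotEnd (ExtPower E a) w w).rTensor (ExtPower E 0) :=
    S.odotEnd_tensor_of_isTrivial _ _ w w
  rw [hw, ← LinearMap.rTensor_mul, odotEnd_extPower_self_mul_self, LinearMap.rTensor_zero]

theorem curvEnd_lieSubmodule_three (a b : ℕ)
    (N : LieSubmodule ℂ S.sp (ExtPower E a ⊗[ℂ] ExtPower E b)) :
    S.curvEnd N R 3 = ((2 * (n : ℂ) ^ 2 + 7 * n + 7) • 1 -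
      (1 / 4 : ℂ) • S.rep N (S.casimir 2)) * S.curvEnd N R 1 := by
  set z : S.Env := S.curvElement R 3 -
    ((2 * (n : ℂ) ^ 2 + 7 * n + 7) • 1 - (1 / 4 : ℂ) • S.casimir 2) * S.curvElement R 1
  have hz : S.rep (ExteriorAlgebra ℂ E ⊗[ℂ] ExteriorAlgebra ℂ E) z = 0 := by
    simpa [z, curvEnd, sub_eq_zero] using S.curvEnd_exterior_tensor_exterior_three hR
  have hN : S.rep N z = 0 :=
    S.rep_eq_zero_of_injective (f := N.incl) Subtype.val_injective
      (S.rep_eq_zero_of_injective (S.map_extPowerIncl_injective a b) hz)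
  simpa [z, curvEnd, sub_eq_zero] using hN

end ExteriorPowers

end SymplecticFrame

end QuaternionKahler

end

open QuaternionKahler

theorem proposition7p1_general {n : ℕ} {E : Type*} [AddCommGroup E] [Module ℂ E]
    (S : SymplecticFrame n E) {R : E →ₗ[ℂ] E →ₗ[ℂ] S.sp} (hR : S.IsHyperCurvature R) (a : ℕ) :
    (∀ (b : ℕ) (N : LieSubmodule ℂ S.sp (ExtPower E a ⊗[ℂ] ExtPower E b)),
      S.curvEnd N R 3 = ((2 * (n : ℂ) ^ 2 + 7 * n + 7) • (1 : Module.End ℂ N) -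
        (1 / 4 : ℂ) • S.rep N (S.casimir 2)) * S.curvEnd N R 1) ∧
    (∀ N : LieSubmodule ℂ S.sp (ExtPower E a ⊗[ℂ] ExtPower E 0), S.curvEnd N R 1 = 0) ∧
    S.curvEnd (ExtPower E a) R 1 = 0 :=
  ⟨S.curvEnd_lieSubmodule_three hR a,
    fun N => S.rep_eq_zero_of_injective (f := N.incl) Subtype.val_injective
      (S.curvEnd_extPower_tensor_extPower_zero_one hR a),
    S.curvEnd_extPower_one hR a⟩

theorem proposition7p1 {n : ℕ} {E : Type*} [AddCommGroup E] [Module ℂ E]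
    (S : QuaternionKahler.SymplecticFrame n E)
    (R : E →ₗ[ℂ] E →ₗ[ℂ] S.sp) (hR : S.IsHyperCurvature R) :
    (∀ (a b : ℕ) (hba : b ≤ a) (ha : a ≤ n),
      S.curvEnd (S.topSummand ha (hba.trans ha)) R 3 =
        ((2 * (n : ℂ) ^ 2 + 7 * n + 7) • (1 : Module.End ℂ (S.topSummand ha (hba.trans ha))) -
          (1 / 4 : ℂ) • S.rep (S.topSummand ha (hba.trans ha)) (S.casimir 2)) *
        S.curvEnd (S.topSummand ha (hba.trans ha)) R 1) ∧
    (∀ (a : ℕ) (ha : a ≤ n),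
      S.curvEnd (S.topSummand ha (Nat.zero_le n)) R 1 = 0 ∧
      ∀ ω ∈ S.primitive a, S.curvEnd (QuaternionKahler.ExtPower E a) R 1 ω = 0) :=
  ⟨fun a b _ _ => (proposition7p1_general S hR a).1 b _,
    fun a _ => ⟨(proposition7p1_general S hR a).2.1 _, fun ω _ => by
      rw [(proposition7p1_general S hR a).2.2, LinearMap.zero_apply]⟩⟩
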